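/- Let $\mathcal P$ be a finite partially ordered set with order $\preceq$, and let $\mathbf n=(n_i)_{i\in\mathcal P}$ be a family of positive integers. Consider square integer matrices $B$ of size $\sum_i n_i$ with block structure $B=(B\{i,j\})_{i,j\in\mathcal P}$, where $B\{i,j\}$ is an $n_i\times n_j$ block; for $S,T\subseteq\mathcal P$ write $B\{S,T\}$ for the submatrix with row blocks in $S$ and column blocks in $T$, $B\{S\}=B\{S,S\}$ and $B\{i\}=B\{i,i\}$. Let $\mathfrak M_{\mathcal P}(\mathbf n,\mathbb Z)$ be the set of those $B$ for which $B\{i,j\}\neq 0$ implies $i\preceq j$, and let $\mathrm{GL}_{\mathcal P}(\mathbf n,\mathbb Z)$ be the set of those $U\in\mathfrak M_{\mathcal P}(\mathbf n,\mathbb Z)$ all of whose diagonal blocks $U\{i\}$ are invertible over $\mathbb Z$. A $\mathrm{GL}_{\mathcal P}$-equivalence $(U,V)\colon B\to B'$ is a pair $U,V\in\mathrm{GL}_{\mathcal P}(\mathbf n,\mathbb Z)$ with $UBV=B'$. Matrices act on column vectors, $\operatorname{cok}M=\mathbb Z^m/M\mathbb Z^m$ for an $m\times m$ matrix $M$, and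 $\gcd M\ge 0$ is the greatest common divisor of all entries of $M$. For $i\in\mathcal P$ let $r_i=\{j: j\prec i\}$ and $c_i=\{j: j\preceq i\}$, and let $\mathcal P_{\min}$ be the set of minimal elements of $\mathcal P$ (those $i$ with $r_i=\emptyset$). The $K$-web $K(B)$ of $B\in\mathfrak M_{\mathcal P}(\mathbf n,\mathbb Z)$ consists of the groups $\operatorname{cok}B\{i\}$ and $\operatorname{cok}B\{c_i\}$ for all $i\in\mathcal P$ (they coincide if $i\in\mathcal P_{\min}$), the groups $\ker B\{i\}$ and $\operatorname{cok}B\{r_i\}$ for all $i\notin\mathcal P_{\min}$, the sequences $$\ker B\{i\}\to\operatorname{cok}B\{r_i\}\to\operatorname{cok}B\{c_i\}\to\operatorname{cok}B\{i\}\qquad(i\notin\mathcal P_{\min}),$$ where the first map is $v\mapsto[B\{r_i,\{i\}\}v]$ and the other two are induced by the inclusion and the projection of coordinates, and the maps $\operatorname{cok}B\{c_j\}\to\operatorname{cok}B\{r_i\}$, induced by the inclusion of coordinates, for all $j$ that are immediate predecessors of $i$. A $K$-web isomorphism $\kappa\colon K(B)\to K(B')$ is a family of isomorphisms between the corresponding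 groups that commute with all these maps. A $\mathrm{GL}_{\mathcal P}$-equivalence $(U,V)\colon B\to B'$ induces the $K$-web isomorphism $\kappa_{(U,V)}$ given by $[x]\mapsto[U\{S\}x]$ on each group $\operatorname{cok}B\{S\}$ and by $v\mapsto V^{-1}\{i\}v$ on each group $\ker B\{i\}$. Suppose that $B,B'\in\mathfrak M_{\mathcal P}(\mathbf n,\mathbb Z)$ satisfy $\gcd B\{i\}=\gcd B'\{i\}\in\{0,1\}$ for all $i\in\mathcal P$. Then for every $K$-web isomorphism $\kappa\colon K(B)\to K(B')$ and every family of isomorphisms $\psi_i\colon\ker B\{i\}\to\ker B'\{i\}$, $i\in\mathcal P_{\min}$, there exist $U,V\in\mathrm{GL}_{\mathcal P}(\mathbf n,\mathbb Z)$ such that $(U,V)$ is a $\mathrm{GL}_{\mathcal P}$-equivalence from $B$ to $B'$ with $\kappa_{(U,V)}=\kappa$ and such that $V^{-1}\{i\}$ induces $\psi_i$, i.e. $\psi_i(v)=V^{-1}\{i\}v$ for all $v\in\ker B\{i\}$, for each $i\in\mathcal P_{\min}$. -/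

import Mathlib

open scoped Matrix

set_option linter.unusedSectionVars false
set_option linter.unusedVariables false

noncomputable section

namespace PosetBlock

variable {P : Type*} [PartialOrder P] [Fintype P] [DecidableEq P] {n : P → ℕ}

/-- Row and column indices of matrices of size `∑ i, n i`, divided into blocks of sizes `n i`. -/
abbrev Idx (n : P → ℕ) : Type _ := Σ i : P, Fin (n i)

/-- The indices that lie in the blocks belonging to `S ⊆ P`. -/
def BlockIdx (n : P → ℕ) (S : Set P) : Type _ := {x : Idx n // x.1 ∈ S}

instance (S : Set P) : Fintype (BlockIdx n S) := by
  classical exact inferInstanceAs (Fintype {x : Idx n // x.1 ∈ S})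

instance (S : Set P) : DecidableEq (BlockIdx n S) := Classical.decEq _

/-- `block B S T` is the part `B{S,T}` of `B`: row blocks in `S`, column blocks in `T`. -/
def block (B : Matrix (Idx n) (Idx n) ℤ) (S T : Set P) :
    Matrix (BlockIdx n S) (BlockIdx n T) ℤ :=
  B.submatrix Subtype.val Subtype.val

/-- `B{S} = B{S,S}`; the `i`-th diagonal block `B{i}` is `dblock B {i}`. -/
abbrev dblock (B : Matrix (Idx n) (Idx n) ℤ) (S : Set P) :
    Matrix (BlockIdx n S) (BlockIdx n S) ℤ :=
  block B S S

/-- `M_P(n, ℤ)`: the block matrices with `B{i,j} = 0` unless `i ≤ j`. -/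
def MP (n : P → ℕ) : Set (Matrix (Idx n) (Idx n) ℤ) :=
  {B | ∀ i j : P, block B {i} {j} ≠ 0 → i ≤ j}

/-- `GL_P(n, ℤ)`: the matrices in `M_P(n, ℤ)` all of whose diagonal blocks are invertible
over `ℤ`. -/
def GLP (n : P → ℕ) : Set (Matrix (Idx n) (Idx n) ℤ) :=
  {U | U ∈ MP n ∧ ∀ i : P, IsUnit (dblock U {i})}

/-- The (nonnegative) greatest common divisor of all entries of `B{i}`. -/
def blockGcd (B : Matrix (Idx n) (Idx n) ℤ) (i : P) : ℤ :=
  Finset.univ.gcd fun p : BlockIdx n {i} × BlockIdx n {i} => dblock B {i} p.1 p.2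

/-- `ker B{S}`, acting on column vectors. -/
abbrev kerS (B : Matrix (Idx n) (Idx n) ℤ) (S : Set P) : Submodule ℤ (BlockIdx n S → ℤ) :=
  LinearMap.ker (dblock B S).mulVecLin

/-- `cok B{S} = ℤ^S / B{S} ℤ^S`, where `ℤ^S` consists of column vectors. -/
abbrev cokS (B : Matrix (Idx n) (Idx n) ℤ) (S : Set P) : Type _ :=
  (BlockIdx n S → ℤ) ⧸ LinearMap.range (dblock B S).mulVecLin

open Classical in
/-- The map `ℤ^S → ℤ^T` that keeps the coordinates in `S ∩ T` and fills up with zeros: the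
inclusion if `S ⊆ T`, the projection if `T ⊆ S`. -/
def coordMap (n : P → ℕ) (S T : Set P) : (BlockIdx n S → ℤ) →ₗ[ℤ] (BlockIdx n T → ℤ) where
  toFun x t := if h : t.1.1 ∈ S then x ⟨t.1, h⟩ else 0
  map_add' x y := by
    funext t
    by_cases h : t.1.1 ∈ S
    · simp only [h, dite_true, Pi.add_apply]
      rfl
    · simp [h]
  map_smul' c x := by
    funext t
    by_cases h : t.1.1 ∈ S
    · simp only [h, dite_true, Pi.smul_apply, RingHom.id_apply]
      rfl
    · simp [h]

/-- The condition on `S` and `T` under which the coordinate map `ℤ^S → ℤ^T` is compatible with all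
matrices in `M_P(n, ℤ)`. -/
def Compat (S T : Set P) : Prop :=
  ∀ t ∈ T, ∀ s ∈ S, t ≤ s → (s ∈ T ↔ t ∈ S)

theorem compat_Iio_Iic (i : P) : Compat (Set.Iio i) (Set.Iic i) := fun _ _ _ hs hts =>
  ⟨fun _ => lt_of_le_of_lt hts hs, fun _ => le_of_lt hs⟩

theorem compat_Iic_singleton (i : P) : Compat (Set.Iic i) {i} := by
  rintro t rfl s hs hts
  exact ⟨fun _ => le_refl _, fun _ => le_antisymm hs hts⟩

theorem compat_Iic_Iio {i j : P} (h : j ⋖ i) : Compat (Set.Iic j) (Set.Iio i) :=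
  fun _ _ _ hs hts => ⟨fun _ => le_trans hts hs, fun _ => lt_of_le_of_lt hs h.lt⟩

theorem MP_apply {B : Matrix (Idx n) (Idx n) ℤ} (hB : B ∈ MP n) {x y : Idx n}
    (h : ¬ x.1 ≤ y.1) : B x y = 0 := by
  by_contra hne
  refine h (hB x.1 y.1 fun h0 => hne ?_)
  exact congrFun (congrFun h0 ⟨x, rfl⟩) ⟨y, rfl⟩

theorem mem_MP {B : Matrix (Idx n) (Idx n) ℤ} (h : ∀ x y : Idx n, ¬ x.1 ≤ y.1 → B x y = 0) :
    B ∈ MP n := by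
  intro i j hne
  by_contra hij
  refine hne ?_
  ext ⟨x, hx⟩ ⟨y, hy⟩
  have hx' : x.1 = i := hx
  have hy' : y.1 = j := hy
  exact h x y (by rw [hx', hy']; exact hij)

open Classical in
theorem sum_block (S : Set P) (f : Idx n → ℤ) :
    ∑ x : BlockIdx n S, f x.1 = ∑ x : Idx n, if x.1 ∈ S then f x else 0 := by
  rw [← Finset.sum_filter]
  symm
  refine Finset.sum_subtype (p := fun x : Idx n => x.1 ∈ S)
    (F := (inferInstance : Fintype (BlockIdx n S))) _ (fun x => ?_) f
  simp

theorem coordMap_comm {B : Matrix (Idx n) (Idx n) ℤ} (hB : B ∈ MP n) {S T : Set P}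
    (h : Compat S T) (x : BlockIdx n S → ℤ) :
    dblock B T *ᵥ coordMap n S T x = coordMap n S T (dblock B S *ᵥ x) := by
  classical
  funext t
  set g : Idx n → ℤ := fun s => if hs : s.1 ∈ S then B t.1 s * x ⟨s, hs⟩ else 0 with hg
  have h1 : (dblock B T *ᵥ coordMap n S T x) t = ∑ s : BlockIdx n T, g s.1 := by
    refine Finset.sum_congr rfl fun s _ => ?_
    by_cases hs : s.1.1 ∈ S
    · simp only [coordMap, hg, hs, dite_true, LinearMap.coe_mk, AddHom.coe_mk]
      rfl
    · simp [coordMap, hg, hs]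
  have h2 : (dblock B S *ᵥ x) = fun u => ∑ s : BlockIdx n S, B u.1 s.1 * x s := rfl
  have h3 : ∑ s : BlockIdx n S, B t.1 s.1 * x s = ∑ s : BlockIdx n S, g s.1 := by
    refine Finset.sum_congr rfl fun s _ => ?_
    have hs : s.1.1 ∈ S := s.2
    simp only [hg, hs, dite_true]
    rfl
  have hz : ∀ s : Idx n, s.1 ∈ S → ¬ t.1.1 ≤ s.1 → g s = 0 := by
    intro s hs hts
    simp [hg, MP_apply hB hts]
  have hz' : ∀ s : Idx n, s.1 ∉ S → g s = 0 := by
    intro s hs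
    simp [hg, hs]
  rw [h1, h2]
  by_cases ht : t.1.1 ∈ S
  · have : coordMap n S T (fun u => ∑ s : BlockIdx n S, B u.1 s.1 * x s) t
        = ∑ s : BlockIdx n S, B t.1 s.1 * x s := by simp [coordMap, ht]
    rw [this, h3, sum_block, sum_block]
    refine Finset.sum_congr rfl fun s _ => ?_
    by_cases hs : s.1 ∈ S
    · by_cases hts : t.1.1 ≤ s.1
      · simp [hs, (h _ t.2 _ hs hts).2 ht]
      · simp [hz s hs hts]
    · simp [hz' s hs]
  · have : coordMap n S T (fun u => ∑ s : BlockIdx n S, B u.1 s.1 * x s) t = 0 := by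
      simp [coordMap, ht]
    rw [this, sum_block]
    refine Finset.sum_eq_zero fun s _ => ?_
    by_cases hs : s.1 ∈ S
    · by_cases hts : t.1.1 ≤ s.1
      · have : s.1 ∉ T := fun h' => ht ((h _ t.2 _ hs hts).1 h')
        simp [this]
      · simp [hz s hs hts]
    · simp [hz' s hs]

/-- The map `cok B{S} → cok B{T}` induced by the coordinate map `ℤ^S → ℤ^T`. -/
def cokMap (B : MP n) {S T : Set P} (h : Compat S T) : cokS B.1 S →ₗ[ℤ] cokS B.1 T :=
  Submodule.mapQ _ _ (coordMap n S T) <| by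
    rintro _ ⟨x, rfl⟩
    exact ⟨coordMap n S T x, coordMap_comm B.2 h x⟩

/-- The connecting map `ker B{i} → cok B{r_i}`, `v ↦ [B{r_i,i} v]`, where `r_i = {j | j < i}`. -/
def connecting (B : MP n) (i : P) : kerS B.1 {i} →ₗ[ℤ] cokS B.1 (Set.Iio i) :=
  (Submodule.mkQ _) ∘ₗ (block B.1 (Set.Iio i) {i}).mulVecLin ∘ₗ (kerS B.1 {i}).subtype

/-- Isomorphisms of `K`-webs.  Put `r_i = {j | j < i}` and `c_i = {j | j ≤ i}`.  The `K`-web of `B`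
consists of the sequences `ker B{i} → cok B{r_i} → cok B{c_i} → cok B{i}` for `i` not minimal,
of the groups `cok B{i} = cok B{c_i}` for `i` minimal, and of the maps `cok B{c_j} → cok B{r_i}`
for `j` an immediate predecessor of `i`.  (For `i` minimal, `cok B{r_i}` is the zero group, so that
the component `cokR i` carries no information, and `comm_ci i` identifies `cokC i` with
`cokI i`.  There is no component on `ker B{i}` for `i` minimal.) -/
@[ext]
structure KWebIso (B B' : MP n) where
  kerI : ∀ i : P, ¬ IsMin i → (kerS B.1 {i} ≃ₗ[ℤ] kerS B'.1 {i})
  cokR : ∀ i : P, cokS B.1 (Set.Iio i) ≃ₗ[ℤ] cokS B'.1 (Set.Iio i)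
  cokC : ∀ i : P, cokS B.1 (Set.Iic i) ≃ₗ[ℤ] cokS B'.1 (Set.Iic i)
  cokI : ∀ i : P, cokS B.1 {i} ≃ₗ[ℤ] cokS B'.1 {i}
  comm_ker : ∀ (i : P) (hi : ¬ IsMin i) (v : kerS B.1 {i}),
    cokR i (connecting B i v) = connecting B' i (kerI i hi v)
  comm_rc : ∀ (i : P) (x : cokS B.1 (Set.Iio i)),
    cokC i (cokMap B (compat_Iio_Iic i) x) = cokMap B' (compat_Iio_Iic i) (cokR i x)
  comm_ci : ∀ (i : P) (x : cokS B.1 (Set.Iic i)),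
    cokI i (cokMap B (compat_Iic_singleton i) x) = cokMap B' (compat_Iic_singleton i) (cokC i x)
  comm_cr : ∀ (i j : P) (h : j ⋖ i) (x : cokS B.1 (Set.Iic j)),
    cokR i (cokMap B (compat_Iic_Iio h) x) = cokMap B' (compat_Iic_Iio h) (cokC j x)

/-- `GL_P`-equivalences `(U, V) : B → B'`. -/
structure GLPEquiv (B B' : MP n) where
  U : Matrix (Idx n) (Idx n) ℤ
  V : Matrix (Idx n) (Idx n) ℤ
  hU : U ∈ GLP n
  hV : V ∈ GLP n
  eq : U * B.1 * V = B'.1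

/-! ### Invertibility in `GL_P` -/

theorem isUnit_of_GLP {U : Matrix (Idx n) (Idx n) ℤ} (hU : U ∈ GLP n) : IsUnit U.det := by
  classical
  let b : Idx n → LinearExtension P := fun x => toLinearExtension x.1
  have hb : U.BlockTriangular b := by
    intro x y hyx
    refine MP_apply hU.1 fun hle => ?_
    exact absurd (toLinearExtension.monotone hle) (not_le_of_gt hyx)
  rw [hb.det]
  refine (IsUnit.prod_iff (M := ℤ)).2 fun k _ => ?_
  obtain ⟨i, rfl⟩ : ∃ i : P, toLinearExtension i = k := ⟨k, rfl⟩
  have h := (Matrix.isUnit_iff_isUnit_det _).1 (hU.2 i)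
  let e : {a : Idx n // b a = toLinearExtension i} ≃ BlockIdx n {i} :=
    Equiv.subtypeEquivRight fun a => Iff.rfl
  have h2 : U.toSquareBlock b (toLinearExtension i) = (dblock U {i}).submatrix e e := rfl
  rw [h2, Matrix.det_submatrix_equiv_self]
  exact h

theorem inv_mem_MP {U : Matrix (Idx n) (Idx n) ℤ} (hU : U ∈ GLP n) : U⁻¹ ∈ MP n := by
  classical
  refine mem_MP fun x y hxy => ?_
  let b : Idx n → Bool := fun z => !decide (z.1 ≤ y.1)
  have : Invertible U := Matrix.invertibleOfIsUnitDet U (isUnit_of_GLP hU)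
  have hb : U.BlockTriangular b := by
    intro z w hwz
    refine MP_apply hU.1 fun hle => ?_
    have h1 : b w = false ∧ b z = true := by
      revert hwz; cases b w <;> cases b z <;> simp
    have h2 : w.1 ≤ y.1 := by simpa [b] using h1.1
    have h3 : ¬ z.1 ≤ y.1 := by simpa [b] using h1.2
    exact h3 (hle.trans h2)
  refine Matrix.blockTriangular_inv_of_blockTriangular hb ?_
  have h1 : b y = false := by simp [b]
  have h2 : b x = true := by simp [b, hxy]
  rw [h1, h2]
  exact Bool.false_lt_true

theorem dblock_mul {M N : Matrix (Idx n) (Idx n) ℤ} (hM : M ∈ MP n) (hN : N ∈ MP n) {S : Set P}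
    (hS : S.OrdConnected) : dblock (M * N) S = dblock M S * dblock N S := by
  classical
  ext x y
  change ∑ k, M x.1 k * N k y.1 = ∑ k : BlockIdx n S, M x.1 k.1 * N k.1 y.1
  rw [sum_block S fun k => M x.1 k * N k y.1]
  refine Finset.sum_congr rfl fun k _ => ?_
  split_ifs with hk
  · rfl
  · by_cases h1 : x.1.1 ≤ k.1
    · by_cases h2 : k.1 ≤ y.1.1
      · exact absurd (hS.out x.2 y.2 ⟨h1, h2⟩) hk
      · rw [MP_apply hN h2, mul_zero]
    · rw [MP_apply hM h1, zero_mul]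

theorem block_mul {M N : Matrix (Idx n) (Idx n) ℤ} (hM : M ∈ MP n) (hN : N ∈ MP n) (i : P) :
    block (M * N) (Set.Iio i) {i} = dblock M (Set.Iio i) * block N (Set.Iio i) {i} +
      block M (Set.Iio i) {i} * dblock N {i} := by
  classical
  ext x y
  have hy : y.1.1 = i := y.2
  change ∑ k, M x.1 k * N k y.1 = ∑ k : BlockIdx n (Set.Iio i), M x.1 k.1 * N k.1 y.1 +
    ∑ k : BlockIdx n {i}, M x.1 k.1 * N k.1 y.1
  rw [sum_block _ fun k => M x.1 k * N k y.1, sum_block _ fun k => M x.1 k * N k y.1,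
    ← Finset.sum_add_distrib]
  refine Finset.sum_congr rfl fun k _ => ?_
  by_cases h2 : k.1 ≤ i
  · rcases h2.lt_or_eq with h | h
    · simp [h, h.ne]
    · simp [h]
  · have : N k y.1 = 0 := MP_apply hN (by rw [hy]; exact h2)
    simp [this]

theorem dblock_one (S : Set P) : dblock (1 : Matrix (Idx n) (Idx n) ℤ) S = 1 :=
  Matrix.submatrix_one _ Subtype.val_injective

theorem dblock_mul_inv {U : Matrix (Idx n) (Idx n) ℤ} (hU : U ∈ GLP n) {S : Set P}
    (hS : S.OrdConnected) : dblock U S * dblock U⁻¹ S = 1 := by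
  rw [← dblock_mul hU.1 (inv_mem_MP hU) hS, Matrix.mul_nonsing_inv _ (isUnit_of_GLP hU), dblock_one]

theorem dblock_inv_mul {U : Matrix (Idx n) (Idx n) ℤ} (hU : U ∈ GLP n) {S : Set P}
    (hS : S.OrdConnected) : dblock U⁻¹ S * dblock U S = 1 := by
  rw [← dblock_mul (inv_mem_MP hU) hU.1 hS, Matrix.nonsing_inv_mul _ (isUnit_of_GLP hU), dblock_one]

namespace GLPEquiv

variable {B B' : MP n} (E : GLPEquiv B B')

theorem mul_eq : E.U * B.1 = B'.1 * E.V⁻¹ := by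
  rw [← E.eq, Matrix.mul_nonsing_inv_cancel_right _ _ (isUnit_of_GLP E.hV)]

theorem dblock_eq {S : Set P} (hS : S.OrdConnected) :
    dblock E.U S * dblock B.1 S = dblock B'.1 S * dblock E.V⁻¹ S := by
  rw [← dblock_mul E.hU.1 B.2 hS, ← dblock_mul B'.2 (inv_mem_MP E.hV) hS, E.mul_eq]

theorem dblock_eq' {S : Set P} (hS : S.OrdConnected) :
    dblock B.1 S * dblock E.V S = dblock E.U⁻¹ S * dblock B'.1 S := by
  have h : B.1 * E.V = E.U⁻¹ * B'.1 := by
    rw [← E.eq, Matrix.mul_assoc, Matrix.nonsing_inv_mul_cancel_left _ _ (isUnit_of_GLP E.hU)]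
  rw [← dblock_mul B.2 E.hV.1 hS, ← dblock_mul (inv_mem_MP E.hU) B'.2 hS, h]

/-- The isomorphism `cok B{S} → cok B'{S}`, `[x] ↦ [U{S} x]`. -/
def cokIso {S : Set P} (hS : S.OrdConnected) : cokS B.1 S ≃ₗ[ℤ] cokS B'.1 S :=
  LinearEquiv.ofLinearMap
    (Submodule.mapQ _ _ (dblock E.U S).mulVecLin (by
      rintro _ ⟨x, rfl⟩
      refine ⟨dblock E.V⁻¹ S *ᵥ x, ?_⟩
      simp [Matrix.mulVec_mulVec, E.dblock_eq hS]))
    (Submodule.mapQ _ _ (dblock E.U⁻¹ S).mulVecLin (by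
      rintro _ ⟨x, rfl⟩
      refine ⟨dblock E.V S *ᵥ x, ?_⟩
      simp [Matrix.mulVec_mulVec, E.dblock_eq' hS]))
    (by
      refine LinearMap.ext fun x => ?_
      obtain ⟨x, rfl⟩ := Submodule.Quotient.mk_surjective _ x
      change Submodule.Quotient.mk (dblock E.U S *ᵥ (dblock E.U⁻¹ S *ᵥ x)) = Submodule.Quotient.mk x
      rw [Matrix.mulVec_mulVec, dblock_mul_inv E.hU hS, Matrix.one_mulVec])
    (by
      refine LinearMap.ext fun x => ?_
      obtain ⟨x, rfl⟩ := Submodule.Quotient.mk_surjective _ x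
      change Submodule.Quotient.mk (dblock E.U⁻¹ S *ᵥ (dblock E.U S *ᵥ x)) = Submodule.Quotient.mk x
      rw [Matrix.mulVec_mulVec, dblock_inv_mul E.hU hS, Matrix.one_mulVec])

/-- The isomorphism `ker B{S} → ker B'{S}`, `v ↦ V⁻¹{S} v`. -/
def kerIso {S : Set P} (hS : S.OrdConnected) : kerS B.1 S ≃ₗ[ℤ] kerS B'.1 S :=
  LinearEquiv.ofLinearMap
    ((dblock E.V⁻¹ S).mulVecLin.restrict (by
      intro v hv
      have hv' : dblock B.1 S *ᵥ v = 0 := hv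
      change dblock B'.1 S *ᵥ (dblock E.V⁻¹ S *ᵥ v) = 0
      rw [Matrix.mulVec_mulVec, ← E.dblock_eq hS, ← Matrix.mulVec_mulVec, hv',
        Matrix.mulVec_zero]))
    ((dblock E.V S).mulVecLin.restrict (by
      intro v hv
      have hv' : dblock B'.1 S *ᵥ v = 0 := hv
      change dblock B.1 S *ᵥ (dblock E.V S *ᵥ v) = 0
      rw [Matrix.mulVec_mulVec, E.dblock_eq' hS, ← Matrix.mulVec_mulVec, hv',
        Matrix.mulVec_zero]))
    (by
      ext1 v
      apply Subtype.ext
      change dblock E.V⁻¹ S *ᵥ (dblock E.V S *ᵥ v.1) = v.1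
      rw [Matrix.mulVec_mulVec, dblock_inv_mul E.hV hS, Matrix.one_mulVec])
    (by
      ext1 v
      apply Subtype.ext
      change dblock E.V S *ᵥ (dblock E.V⁻¹ S *ᵥ v.1) = v.1
      rw [Matrix.mulVec_mulVec, dblock_mul_inv E.hV hS, Matrix.one_mulVec])

theorem cokIso_comm {S T : Set P} (hS : S.OrdConnected) (hT : T.OrdConnected) (h : Compat S T)
    (x : cokS B.1 S) :
    E.cokIso hT (cokMap B h x) = cokMap B' h (E.cokIso hS x) := by
  obtain ⟨x, rfl⟩ := Submodule.Quotient.mk_surjective _ x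
  change Submodule.Quotient.mk (dblock E.U T *ᵥ coordMap n S T x) =
    Submodule.Quotient.mk (coordMap n S T (dblock E.U S *ᵥ x))
  rw [coordMap_comm E.hU.1 h]

theorem connecting_comm (i : P) (v : kerS B.1 {i}) :
    E.cokIso Set.ordConnected_Iio (connecting B i v) =
      connecting B' i (E.kerIso Set.ordConnected_singleton v) := by
  change Submodule.Quotient.mk
      (dblock E.U (Set.Iio i) *ᵥ (block B.1 (Set.Iio i) {i} *ᵥ v.1)) =
    Submodule.Quotient.mk (block B'.1 (Set.Iio i) {i} *ᵥ (dblock E.V⁻¹ {i} *ᵥ v.1))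
  have hv : dblock B.1 {i} *ᵥ v.1 = 0 := v.2
  have h1 := congrArg (fun M => M *ᵥ v.1) (block_mul E.hU.1 B.2 i)
  have h2 := congrArg (fun M => M *ᵥ v.1) (block_mul B'.2 (inv_mem_MP E.hV) i)
  simp only [Matrix.add_mulVec, ← Matrix.mulVec_mulVec, hv, Matrix.mulVec_zero, add_zero] at h1 h2
  rw [E.mul_eq, h2] at h1
  rw [Submodule.Quotient.eq, ← h1, add_sub_cancel_right]
  exact ⟨_, rfl⟩

/-- The `K`-web isomorphism `κ_(U,V)` induced by a `GL_P`-equivalence `(U, V) : B → B'`. -/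
def toKWebIso : KWebIso B B' where
  kerI _ _ := E.kerIso Set.ordConnected_singleton
  cokR _ := E.cokIso Set.ordConnected_Iio
  cokC _ := E.cokIso Set.ordConnected_Iic
  cokI _ := E.cokIso Set.ordConnected_singleton
  comm_ker i _ v := E.connecting_comm i v
  comm_rc _ _ := E.cokIso_comm _ _ _ _
  comm_ci _ _ := E.cokIso_comm _ _ _ _
  comm_cr _ _ _ _ := E.cokIso_comm _ _ _ _

end GLPEquiv

end PosetBlock

end

/-! Each isomorphism `cok B{i} → cok B'{i}` lifts to some `e i` in `GL(n_i, ℤ)`; this is where the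
gcd condition enters. If the gcd is `0`, both blocks vanish and there is nothing to lift. If it is
`1`, some `w` in the image of `B{i}` has value one under a functional `l`, so the cokernel is
already generated by the image of `ker l`, of rank `n_i - 1`; two presentations of a group by free
modules of equal rank are isomorphic as soon as one generator is superfluous
(`exists_equiv_of_surjective`).

The rest is lifting along free modules. The column block of `U` at `i` lifts `cokC i` on `ℤ^i`, with
diagonal part `e i` (`exists_inducing_cok`); the maps of the `K`-web then force `U` to induce `κ` on
all cokernels. Next, `U B = B' W` is solved for `W = V⁻¹` one column block at a time, with the
action on `ker B{i}` prescribed (`exists_column`); compatibility with the connecting map is exactly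
what makes this solvable. Finally each `W{i}` is invertible by the five lemma argument of
`surjective_of_ker_cok`. -/

/-! ### Cyclic quotients of finitely generated abelian groups -/

/-- Bézout's identity for a finite family of integers without a common nonunit divisor. -/
theorem Int.exists_sum_mul_eq_one {ι : Type*} [Fintype ι] (c : ι → ℤ)
    (h : ∀ g : ℤ, (∀ i, g ∣ c i) → IsUnit g) : ∃ k : ι → ℤ, ∑ i, k i * c i = 1 := by
  have h1 : (1 : ℤ) ∈ Ideal.span (Set.range c) := by
    obtain ⟨g, hg⟩ := (inferInstance : (Ideal.span (Set.range c)).IsPrincipal)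
    have hu : IsUnit g := h g fun i => by
      have : c i ∈ Ideal.span (Set.range c) := Ideal.subset_span ⟨i, rfl⟩
      rw [hg] at this
      exact Ideal.mem_span_singleton.1 this
    rw [hg]
    exact Ideal.mem_span_singleton.2 hu.dvd
  exact Ideal.mem_span_range_iff_exists_fun.1 h1

/-- A finite product of finite cyclic groups has a cyclic quotient of the same exponent. -/
theorem exists_surjective_zmod_pi {ι : Type*} [Fintype ι] [DecidableEq ι] (a : ι → ℕ)
    (ha : ∀ i, a i ≠ 0) :
    ∃ (d : ℕ) (χ : (∀ i, ZMod (a i)) →+ ZMod d), Function.Surjective χ ∧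
      ∀ x : ∀ i, ZMod (a i), d • x = 0 := by
  -- The lcm is the exponent of the product. The character sends the `i`-th generator to `d / a i`,
  -- so it is surjective once these numbers have gcd one.
  set d := Finset.univ.lcm a with hd
  have had : ∀ i, a i ∣ d := fun i => Finset.dvd_lcm (Finset.mem_univ i)
  have hd0 : d ≠ 0 := by
    rw [hd, Ne, Finset.lcm_eq_zero_iff]
    simpa using ha
  have hlift : ∀ i, zmultiplesHom (ZMod d) ((d / a i : ℕ) : ZMod d) (a i : ℤ) = 0 := by
    intro i
    rw [zmultiplesHom_apply, natCast_zsmul, nsmul_eq_mul, ← Nat.cast_mul,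
      Nat.mul_div_cancel' (had i), ZMod.natCast_self]
  let f : ∀ i, ZMod (a i) →+ ZMod d := fun i => ZMod.lift (a i) ⟨_, hlift i⟩
  let χ : (∀ i, ZMod (a i)) →+ ZMod d := ∑ i, (f i).comp (Pi.evalAddMonoidHom _ i)
  have hχ : ∀ k : ι → ℤ, χ (fun i => (k i : ZMod (a i))) =
      ((∑ i, k i * ((d / a i : ℕ) : ℤ) : ℤ) : ZMod d) := by
    intro k
    simp only [χ, f, AddMonoidHom.finsetSum_apply, AddMonoidHom.comp_apply,
      Pi.evalAddMonoidHom_apply, ZMod.lift_coe, zmultiplesHom_apply, zsmul_eq_mul]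
    simp only [Int.cast_sum, Int.cast_mul, Int.cast_natCast]
  refine ⟨d, χ, ?_, ?_⟩
  · rcases isEmpty_or_nonempty ι with hι | ⟨⟨i₀⟩⟩
    · have h1 : d = 1 := by simp [hd]
      have : Subsingleton (ZMod d) := by rw [h1]; infer_instance
      exact fun z => ⟨0, Subsingleton.elim _ _⟩
    -- A common divisor `g` of all `d / a i` makes `d / |g|` a common multiple of the `a i`, so `|g|
    -- = 1` by minimality of the lcm.
    obtain ⟨k, hk⟩ := Int.exists_sum_mul_eq_one (fun i => ((d / a i : ℕ) : ℤ)) (by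
      intro g hg
      have hgd : g.natAbs ∣ d :=
        (Int.natAbs_dvd_natAbs.2 (hg i₀)).trans (Nat.div_dvd_of_dvd (had i₀))
      obtain ⟨c, hc⟩ := hgd
      have h3 : 0 < g.natAbs := Nat.pos_of_ne_zero fun h => hd0 (by rw [hc, h, zero_mul])
      have hdc : d ∣ c := Finset.lcm_dvd fun i _ => by
        obtain ⟨e, he⟩ : g.natAbs ∣ d / a i := Int.natAbs_dvd_natAbs.2 (hg i)
        refine ⟨e, Nat.eq_of_mul_eq_mul_left h3 ?_⟩
        rw [← hc, ← Nat.mul_div_cancel' (had i), he]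
        ring
      rw [Int.isUnit_iff_natAbs_eq]
      have hc0 : c ≠ 0 := fun h => hd0 (by rw [hc, h, mul_zero])
      have h4 := Nat.le_of_dvd (Nat.pos_of_ne_zero hc0) hdc
      rw [hc] at h4
      have h5 : g.natAbs ≤ 1 :=
        Nat.le_of_mul_le_mul_right (by simpa using h4) (Nat.pos_of_ne_zero hc0)
      omega)
    intro z
    obtain ⟨z, rfl⟩ := ZMod.intCast_surjective z
    refine ⟨fun i => ((z * k i : ℤ) : ZMod (a i)), ?_⟩
    rw [hχ]
    simp only [mul_assoc, ← Finset.mul_sum]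
    rw [hk, mul_one]
  · intro x
    funext i
    obtain ⟨e, he⟩ := had i
    simp [he, nsmul_eq_mul]

/-- A finitely generated abelian group has a cyclic quotient with the same annihilator. -/
theorem exists_surjective_zmod (G : Type*) [AddCommGroup G] [Module.Finite ℤ G] :
    ∃ (d : ℕ) (χ : G →ₗ[ℤ] ZMod d), Function.Surjective χ ∧ ∀ x : G, (d : ℤ) • x = 0 := by
  classical
  have : AddGroup.FG G := Module.Finite.iff_addGroup_fg.1 inferInstance
  obtain ⟨r, ι, _, p, hp, e, ⟨E⟩⟩ := AddCommGroup.equiv_free_prod_directSum_zmod G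
  rcases Nat.eq_zero_or_pos r with rfl | hr
  · obtain ⟨d, χ, hχ, hd⟩ := exists_surjective_zmod_pi (fun i => p i ^ e i)
      (fun i => pow_ne_zero _ (hp i).ne_zero)
    let F : G ≃+ ∀ i, ZMod (p i ^ e i) :=
      (E.trans AddEquiv.uniqueProd).trans (DirectSum.addEquivProd _)
    refine ⟨d, (χ.comp F.toAddMonoidHom).toIntLinearMap, hχ.comp F.surjective, fun x => ?_⟩
    apply F.injective
    rw [map_zsmul, map_zero, natCast_zsmul, hd]
  -- With positive free rank a coordinate maps onto `ℤ = ZMod 0`, and `d = 0` kills everything.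
  · let χ : G →+ ℤ := (Finsupp.applyAddHom (⟨0, hr⟩ : Fin r)).comp
      ((AddMonoidHom.fst _ _).comp E.toAddMonoidHom)
    have hχ : Function.Surjective χ := fun z =>
      ⟨E.symm (Finsupp.single ⟨0, hr⟩ z, 0), by simp [χ]⟩
    exact ⟨0, χ.toIntLinearMap, hχ, fun x => by simp⟩

/-! ### Integral functionals on free modules -/

section Functionals

variable {M : Type*} [AddCommGroup M]

/-- The splitting of a module along a functional that takes the value one. -/
def kerProdEquiv (l : M →ₗ[ℤ] ℤ) (w : M) (hw : l w = 1) : M ≃ₗ[ℤ] LinearMap.ker l × ℤ where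
  toFun v := (⟨v - l v • w, by simp [hw]⟩, l v)
  map_add' u v := by
    ext
    · simp only [map_add, Prod.mk_add_mk, AddMemClass.mk_add_mk, add_smul]
      abel
    · simp
  map_smul' c v := by
    ext
    · simp [smul_sub, mul_smul]
    · simp
  invFun x := x.1 + x.2 • w
  left_inv v := by simp
  right_inv x := by
    have : l x.1 = 0 := x.1.2
    ext
    · simp [this, hw]
    · simp [this, hw]

variable [Module.Free ℤ M] [Module.Finite ℤ M]

theorem finrank_ker_add_one (l : M →ₗ[ℤ] ℤ) (w : M) (hw : l w = 1) :
    Module.finrank ℤ (LinearMap.ker l) + 1 = Module.finrank ℤ M := by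
  rw [(kerProdEquiv l w hw).finrank_eq, Module.finrank_prod, Module.finrank_self]

/-- Every functional is a multiple of one that takes the value one. -/
theorem exists_eq_smul_functional (hM : Module.finrank ℤ M ≠ 0) (l : M →ₗ[ℤ] ℤ) :
    ∃ (g : ℤ) (l₀ : M →ₗ[ℤ] ℤ) (w : M), l₀ w = 1 ∧ l = g • l₀ := by
  obtain ⟨g, hg⟩ := (inferInstance : (LinearMap.range l).IsPrincipal)
  -- The zero functional is `0` times a coordinate functional, which exists because the rank is
  -- nonzero. Otherwise the functional is divided by the generator of its image.
  by_cases h0 : g = 0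
  · have hl : l = 0 := by
      rw [← LinearMap.range_eq_bot, hg, h0, Submodule.span_singleton_eq_bot]
    let b := Module.finBasis ℤ M
    let i : Fin (Module.finrank ℤ M) := ⟨0, Nat.pos_of_ne_zero hM⟩
    exact ⟨0, b.coord i, b i, by simp, by simp [hl]⟩
  · have hdvd : ∀ v, g ∣ l v := fun v => by
      have : l v ∈ LinearMap.range l := ⟨v, rfl⟩
      rw [hg] at this
      exact Ideal.mem_span_singleton.1 this
    have hmem : g ∈ LinearMap.range l := by rw [hg]; exact Submodule.mem_span_singleton_self g
    obtain ⟨w, hw⟩ := hmem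
    refine ⟨g, { toFun := fun v => l v / g, map_add' := fun u v => ?_, map_smul' := fun c v => ?_ },
      w, ?_, ?_⟩
    · rw [map_add, Int.add_ediv_of_dvd_left (hdvd u)]
    · rw [map_smul, smul_eq_mul, Int.mul_ediv_assoc _ (hdvd v)]
      rfl
    · simp [hw, h0]
    · ext v
      simp [Int.mul_ediv_cancel' (hdvd v)]

/-- A homomorphism from a free module to a cyclic group lifts to a functional. -/
theorem exists_functional_lift {d : ℕ} (χ : M →ₗ[ℤ] ZMod d) :
    ∃ l : M →ₗ[ℤ] ℤ, ∀ v, ((l v : ℤ) : ZMod d) = χ v := by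
  obtain ⟨l, hl⟩ := Module.projective_lifting_property
    (Int.castAddHom (ZMod d)).toIntLinearMap χ ZMod.intCast_surjective
  exact ⟨l, fun v => LinearMap.congr_fun hl v⟩

/-- A surjection from a free module of rank at least two to a cyclic group lifts to a surjective
functional. -/
theorem exists_surjective_functional_lift (hM : 2 ≤ Module.finrank ℤ M) {d : ℕ}
    (χ : M →ₗ[ℤ] ZMod d) (hχ : Function.Surjective χ) :
    ∃ (l : M →ₗ[ℤ] ℤ) (w : M), l w = 1 ∧ ∀ v, ((l v : ℤ) : ZMod d) = χ v := by
  obtain ⟨l, hl⟩ := exists_functional_lift χ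
  obtain ⟨g, l₀, w, hw, rfl⟩ := exists_eq_smul_functional (by omega) l
  have hk := finrank_ker_add_one l₀ w hw
  -- Applied to the zero functional, this just supplies a functional `m` on `ker l₀` with `m u = 1`;
  -- here rank at least two is needed. Its extension `l₁` vanishes at `w`.
  obtain ⟨-, m, u, hu, -⟩ := exists_eq_smul_functional (M := LinearMap.ker l₀) (by omega) 0
  let l₁ : M →ₗ[ℤ] ℤ := m ∘ₗ LinearMap.fst ℤ _ _ ∘ₗ (kerProdEquiv l₀ w hw).toLinearMap
  have h1w : l₁ w = 0 := by
    have : (kerProdEquiv l₀ w hw w).1 = 0 := Subtype.ext (by simp [kerProdEquiv, hw])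
    simp [l₁, this]
  have h1u : l₁ u = 1 := by
    have hu0 : l₀ u = 0 := u.2
    have : (kerProdEquiv l₀ w hw u).1 = u := Subtype.ext (by simp [kerProdEquiv, hu0])
    simp [l₁, this, hu]
  -- Surjectivity of `χ` makes `g` a unit modulo `d`. Adding `d • l₁` does not change the reduction,
  -- and `g • l₀ + d • l₁` takes the value `a g + b d = 1` at `a • w + b • u`.
  have hgd : ∃ a b : ℤ, a * g + b * d = 1 := by
    obtain ⟨v, hv⟩ := hχ 1
    have h2 := hl v
    rw [hv] at h2
    have h3 : (((1 - l₀ v * g : ℤ)) : ZMod d) = 0 := by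
      rw [Int.cast_sub, Int.cast_one, ← h2]
      simp [mul_comm]
    obtain ⟨b, hb⟩ := (ZMod.intCast_zmod_eq_zero_iff_dvd _ _).1 h3
    exact ⟨l₀ v, b, by linarith⟩
  obtain ⟨a, b, hab⟩ := hgd
  have hu0 : l₀ u = 0 := u.2
  refine ⟨g • l₀ + (d : ℤ) • l₁, a • w + b • (u : M), ?_, fun v => ?_⟩
  · simp only [LinearMap.add_apply, LinearMap.smul_apply, map_add, map_smul, hw, h1w, h1u, hu0,
      smul_eq_mul]
    linarith
  · rw [← hl v]
    simp

end Functionals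

/-! ### Lifting isomorphisms of cokernels -/

/-- A surjection onto a group with a cyclic quotient of the same annihilator restricts to a
surjection between the kernels of compatible functionals. -/
theorem exists_surjective_ker_ker {A G : Type*} [AddCommGroup A] [AddCommGroup G] {d : ℕ}
    (χ : G →ₗ[ℤ] ZMod d) (hχ : Function.Surjective χ) (hd : ∀ x : G, (d : ℤ) • x = 0)
    (t : A →ₗ[ℤ] G) (ht : Function.Surjective t) (l : A →ₗ[ℤ] ℤ) (w : A) (hw : l w = 1) (g : ℤ)
    (hl : ∀ v, ((g * l v : ℤ) : ZMod d) = χ (t v)) :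
    ∃ t' : LinearMap.ker l →ₗ[ℤ] LinearMap.ker χ, (∀ v, (t' v : G) = t v) ∧
      Function.Surjective t' := by
  refine ⟨(t ∘ₗ (LinearMap.ker l).subtype).codRestrict _ ?_, fun v => rfl, ?_⟩
  · intro v
    have : l v = 0 := v.2
    simp [LinearMap.mem_ker, ← hl, this]
  · rintro ⟨x, hx⟩
    obtain ⟨v, rfl⟩ := ht x
    obtain ⟨y, hy⟩ := hχ 1
    obtain ⟨y, rfl⟩ := ht y
    have hgv : ((g * l v : ℤ) : ZMod d) = 0 := by rw [hl]; exact hx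
    -- The element `y` shows that `g` is a unit modulo `d`, so `d ∣ l v`. Hence `t` kills `l v • w`,
    -- and subtracting it moves `v` into `ker l` without changing its image.
    have hlv : ((l v : ℤ) : ZMod d) = 0 := by
      have h1 : ((g * l y : ℤ) : ZMod d) = 1 := by rw [hl, hy]
      push_cast at h1 hgv
      calc ((l v : ℤ) : ZMod d) = ((g : ZMod d) * (l y : ℤ)) * (l v : ℤ) := by rw [h1, one_mul]
        _ = ((g : ZMod d) * (l v : ℤ)) * (l y : ℤ) := by ring
        _ = 0 := by rw [hgv, zero_mul]
    obtain ⟨b, hb⟩ := (ZMod.intCast_zmod_eq_zero_iff_dvd _ _).1 hlv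
    refine ⟨⟨v - l v • w, by simp [hw]⟩, Subtype.ext ?_⟩
    change t (v - l v • w) = t v
    rw [hb, mul_comm, mul_smul, map_sub, map_smul, map_smul, smul_comm, hd, sub_zero]

/-- Two presentations of an abelian group by free modules of the same rank are isomorphic if the
group can be generated by fewer elements than that rank. -/
theorem exists_equiv_of_surjective (m : ℕ) : ∀ {G N M M' : Type*}
    [AddCommGroup G] [AddCommGroup N] [AddCommGroup M] [AddCommGroup M']
    [Module.Free ℤ N] [Module.Finite ℤ N] [Module.Free ℤ M] [Module.Finite ℤ M]
    [Module.Free ℤ M'] [Module.Finite ℤ M'],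
    Module.finrank ℤ N = m → Module.finrank ℤ M = m + 1 → Module.finrank ℤ M' = m + 1 →
    ∀ (s : N →ₗ[ℤ] G) (p : M →ₗ[ℤ] G) (q : M' →ₗ[ℤ] G), Function.Surjective s →
    Function.Surjective p → Function.Surjective q → ∃ e : M ≃ₗ[ℤ] M', ∀ v, q (e v) = p v := by
  induction m with
  | zero =>
    intro G N M M' _ _ _ _ _ _ _ _ _ _ hN hM hM' s p q hs hp hq
    have : Subsingleton N := Module.finrank_zero_iff.1 hN
    have : Subsingleton G := hs.subsingleton
    exact ⟨LinearEquiv.ofFinrankEq _ _ (hM.trans hM'.symm), fun v => Subsingleton.elim _ _⟩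
  | succ m ih =>
    intro G N M M' _ _ _ _ _ _ _ _ _ _ hN hM hM' s p q hs hp hq
    have : Module.Finite ℤ G := Module.Finite.of_surjective s hs
    -- The induction passes from `G` to `ker χ` and from the free modules to kernels of functionals
    -- over `χ`, which lowers all ranks by one. `N` may have rank one, so its functional need not be
    -- surjective: a multiple `g • l₀` has to do.
    obtain ⟨d, χ, hχ, hd⟩ := exists_surjective_zmod G
    obtain ⟨lN, hlN⟩ := exists_functional_lift (χ ∘ₗ s)
    obtain ⟨g, l₀, wN, hwN, rfl⟩ := exists_eq_smul_functional (by omega) lN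
    obtain ⟨l, w, hw, hl⟩ := exists_surjective_functional_lift (by omega) (χ ∘ₗ p) (hχ.comp hp)
    obtain ⟨l', w', hw', hl'⟩ := exists_surjective_functional_lift (by omega) (χ ∘ₗ q) (hχ.comp hq)
    obtain ⟨s₁, hs₁, hs₁'⟩ := exists_surjective_ker_ker χ hχ hd s hs l₀ wN hwN g (fun v => by simpa using hlN v)
    obtain ⟨p₁, hp₁, hp₁'⟩ := exists_surjective_ker_ker χ hχ hd p hp l w hw 1 (fun v => by simpa using hl v)
    obtain ⟨q₁, hq₁, hq₁'⟩ := exists_surjective_ker_ker χ hχ hd q hq l' w' hw' 1 (fun v => by simpa using hl' v)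
    have rN := finrank_ker_add_one l₀ wN hwN
    have rM := finrank_ker_add_one l w hw
    have rM' := finrank_ker_add_one l' w' hw'
    obtain ⟨e, he⟩ := ih (by omega) (by omega) (by omega) s₁ p₁ q₁ hs₁' hp₁' hq₁'
    have hmem : p w - q w' ∈ LinearMap.ker χ := by
      have h1 := hl w
      have h2 := hl' w'
      simp only [hw, hw', LinearMap.comp_apply] at h1 h2
      rw [LinearMap.mem_ker, map_sub, ← h1, ← h2, sub_self]
    -- Correcting `w'` by `u ∈ ker l'` gives `q (w' + u) = p w`, so `e` extends by `w ↦ w' + u`.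
    obtain ⟨u, hu⟩ := hq₁' ⟨_, hmem⟩
    have hu' : q u = p w - q w' := by rw [← hq₁, hu]
    have hw2 : l' (w' + u) = 1 := by
      have : l' u = 0 := u.2
      simp [hw', this]
    refine ⟨(kerProdEquiv l w hw).trans ((e.prodCongr (LinearEquiv.refl ℤ ℤ)).trans
      (kerProdEquiv l' _ hw2).symm), fun v => ?_⟩
    have h3 : ∀ x : LinearMap.ker l, q (e x) = p x := fun x => by rw [← hq₁, he, hp₁]
    change q ((e ((kerProdEquiv l w hw v).1) : M') + l v • (w' + (u : M'))) = p v
    rw [map_add, h3, map_smul, map_add, hu']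
    change p (v - l v • w) + _ = _
    simp

/-- Every isomorphism between the cokernels of two integer square matrices of the same size whose
entries have greatest common divisor one is induced by an automorphism of `ℤ^ι`. -/
theorem exists_equiv_lift_of_gcd_eq_one {ι : Type*} [Fintype ι] [DecidableEq ι]
    (A A' : Matrix ι ι ℤ) (hA : ∀ g : ℤ, (∀ i j, g ∣ A i j) → IsUnit g)
    (φ : ((ι → ℤ) ⧸ LinearMap.range A.mulVecLin) ≃ₗ[ℤ] ((ι → ℤ) ⧸ LinearMap.range A'.mulVecLin)) :
    ∃ e : (ι → ℤ) ≃ₗ[ℤ] (ι → ℤ), ∀ v, φ (Submodule.Quotient.mk v) = Submodule.Quotient.mk (e v) := by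
  obtain ⟨r, S⟩ := Submodule.smithNormalForm (Pi.basisFun ℤ ι) (LinearMap.range A.mulVecLin)
  have hdvd : ∀ g : ℤ, (∀ i, g ∣ S.a i) → IsUnit g := by
    intro g hg
    refine hA g fun i j => ?_
    have hmem : A.mulVecLin (Pi.single j 1) ∈ LinearMap.range A.mulVecLin := ⟨_, rfl⟩
    have hv : ∀ v : LinearMap.range A.mulVecLin, ∀ i, g ∣ (v : ι → ℤ) i := by
      intro v i
      have h1 := congrArg (fun x : LinearMap.range A.mulVecLin => (x : ι → ℤ) i) (S.bN.sum_repr v)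
      simp only [Submodule.coe_sum, Submodule.coe_smul, S.snf, Finset.sum_apply, Pi.smul_apply,
        smul_eq_mul] at h1
      rw [← h1]
      exact Finset.dvd_sum fun k _ => ((hg k).mul_right _).mul_left _
    have := hv ⟨_, hmem⟩ i
    simpa using this
  obtain ⟨k, hk⟩ := Int.exists_sum_mul_eq_one S.a hdvd
  -- The sum of the coordinates in the Smith basis takes the value `∑ k i * a i = 1` at the element
  -- `w` of the image. Thus `ker l` still surjects onto the cokernel.
  let l : (ι → ℤ) →ₗ[ℤ] ℤ := S.bM.constr ℤ fun _ => (1 : ℤ)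
  let w : LinearMap.range A.mulVecLin := ∑ i, k i • S.bN i
  have hw : l w = 1 := by
    simp only [w, Submodule.coe_sum, Submodule.coe_smul, S.snf, map_sum, map_smul, l,
      Module.Basis.constr_basis, smul_eq_mul, mul_one, hk]
  have hr := finrank_ker_add_one l w hw
  obtain ⟨e, he⟩ := exists_equiv_of_surjective _ (rfl : Module.finrank ℤ (LinearMap.ker l) = _)
    hr.symm hr.symm
    (φ.toLinearMap ∘ₗ Submodule.mkQ _ ∘ₗ (LinearMap.ker l).subtype)
    (φ.toLinearMap ∘ₗ Submodule.mkQ _) (Submodule.mkQ _) (by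
      intro x
      obtain ⟨x, rfl⟩ := φ.surjective x
      obtain ⟨x, rfl⟩ := Submodule.mkQ_surjective _ x
      refine ⟨⟨x - l x • (w : ι → ℤ), by
        rw [LinearMap.mem_ker, map_sub, map_smul, hw, smul_eq_mul, mul_one, sub_self]⟩, ?_⟩
      have h0 : Submodule.mkQ (LinearMap.range A.mulVecLin) w = 0 := by simp
      simp only [LinearMap.comp_apply, Submodule.subtype_apply, map_sub, map_smul, h0, smul_zero,
        sub_zero]
      rfl)
    (φ.surjective.comp (Submodule.mkQ_surjective _)) (Submodule.mkQ_surjective _)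
  exact ⟨e, fun v => (he v).symm⟩

/-- A linear map from a projective module lifts along any linear map whose range contains its
values. -/
theorem exists_comp_eq_of_forall_mem_range {R K L N : Type*} [Ring R] [AddCommGroup K]
    [AddCommGroup L] [AddCommGroup N] [Module R K] [Module R L] [Module R N]
    [Module.Projective R K] (f : L →ₗ[R] N) (t : K →ₗ[R] N) (h : ∀ k, ∃ x, f x = t k) :
    ∃ s : K →ₗ[R] L, ∀ k, f (s k) = t k := by
  obtain ⟨s, hs⟩ := Module.projective_lifting_property f.rangeRestrict
    (t.codRestrict (LinearMap.range f) h) f.surjective_rangeRestrict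
  exact ⟨s, fun k => congrArg Subtype.val (LinearMap.congr_fun hs k)⟩

noncomputable section

namespace PosetBlock

variable {P : Type*} [PartialOrder P] [Fintype P] [DecidableEq P] {n : P → ℕ}

/-- For gcd zero both diagonal blocks vanish, so `φ` itself is an automorphism of `ℤ^i`; for gcd one
the cokernel has a superfluous generator. -/
theorem exists_equiv_lift_cok {B B' : MP n} {i : P}
    (hgcd : blockGcd B.1 i = blockGcd B'.1 i ∧ (blockGcd B.1 i = 0 ∨ blockGcd B.1 i = 1))
    (φ : cokS B.1 {i} ≃ₗ[ℤ] cokS B'.1 {i}) :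
    ∃ e : (BlockIdx n {i} → ℤ) ≃ₗ[ℤ] (BlockIdx n {i} → ℤ),
      ∀ v, φ (Submodule.Quotient.mk v) = Submodule.Quotient.mk (e v) := by
  obtain ⟨h, h0 | h1⟩ := hgcd
  · have key : ∀ C : Matrix (Idx n) (Idx n) ℤ, blockGcd C i = 0 →
        LinearMap.range (dblock C {i}).mulVecLin = ⊥ := by
      intro C hC
      have : dblock C {i} = 0 := by
        ext x y
        exact Finset.gcd_eq_zero_iff.1 hC (x, y) (Finset.mem_univ _)
      rw [this, Matrix.mulVecLin_zero, LinearMap.range_zero]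
    refine ⟨((Submodule.quotEquivOfEqBot _ (key _ h0)).symm.trans φ).trans
      (Submodule.quotEquivOfEqBot _ (key _ (h ▸ h0))), fun v => ?_⟩
    apply (Submodule.quotEquivOfEqBot _ (key _ (h ▸ h0))).injective
    simp
  · refine exists_equiv_lift_of_gcd_eq_one _ _ (fun g hg => ?_) φ
    have : g ∣ blockGcd B.1 i := Finset.dvd_gcd fun p _ => hg p.1 p.2
    rw [h1] at this
    exact isUnit_of_dvd_one this

/-! ### Block coordinates and matrices given by column blocks -/

theorem coordMap_apply_of_mem (S T : Set P) (v : BlockIdx n S → ℤ) (t : BlockIdx n T)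
    (h : t.1.1 ∈ S) : coordMap n S T v t = v ⟨t.1, h⟩ := by
  simp [coordMap, h]

theorem coordMap_apply_of_notMem (S T : Set P) (v : BlockIdx n S → ℤ) (t : BlockIdx n T)
    (h : t.1.1 ∉ S) : coordMap n S T v t = 0 := by
  simp [coordMap, h]

/-- The unit vector in `ℤ^S` that belongs to the index `x`. -/
def unitVec (S : Set P) (x : Idx n) : BlockIdx n S → ℤ := fun t => if t.1 = x then 1 else 0

theorem unitVec_eq_single (S : Set P) (x : BlockIdx n S) : unitVec S x.1 = Pi.single x 1 := by
  funext t
  by_cases h : t = x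
  · rw [h, Pi.single_eq_same]
    exact if_pos rfl
  · rw [Pi.single_eq_of_ne h]
    exact if_neg fun h' => h (Subtype.ext h')

theorem linearMap_ext_unitVec {S : Set P} {N : Type*} [AddCommGroup N]
    {f g : (BlockIdx n S → ℤ) →ₗ[ℤ] N}
    (h : ∀ x : Idx n, x.1 ∈ S → f (unitVec S x) = g (unitVec S x)) : f = g :=
  (Pi.basisFun ℤ _).ext fun x => by
    rw [Pi.basisFun_apply, ← unitVec_eq_single]
    exact h x.1 x.2

theorem coordMap_unitVec {S T : Set P} (x : Idx n) (hS : x.1 ∈ S) :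
    coordMap n S T (unitVec S x) = unitVec T x := by
  funext t
  by_cases ht : t.1.1 ∈ S
  · rw [coordMap_apply_of_mem _ _ _ _ ht]
    rfl
  · rw [coordMap_apply_of_notMem _ _ _ _ ht]
    exact (if_neg fun h => ht (by rw [h]; exact hS)).symm

theorem dblock_mulVec_unitVec (B : Matrix (Idx n) (Idx n) ℤ) {S : Set P} (x : Idx n)
    (hS : x.1 ∈ S) : dblock B S *ᵥ unitVec S x = fun t => B t.1 x := by
  obtain ⟨x, rfl⟩ : ∃ y : BlockIdx n S, y.1 = x := ⟨⟨x, hS⟩, rfl⟩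
  rw [unitVec_eq_single, Matrix.mulVec_single_one]
  rfl

theorem coordMap_singleton_Iic (i : P) (v : BlockIdx n {i} → ℤ) :
    coordMap n (Set.Iic i) {i} (coordMap n {i} (Set.Iic i) v) = v := by
  funext t
  have ht : t.1.1 = i := t.2
  rw [coordMap_apply_of_mem _ _ _ _ (show t.1.1 ∈ Set.Iic i from ht.le)]
  exact coordMap_apply_of_mem _ _ _ _ (show t.1.1 ∈ ({i} : Set P) from ht)

theorem coordMap_Iio_Iic_singleton (i : P) (v : BlockIdx n (Set.Iio i) → ℤ) :
    coordMap n (Set.Iic i) {i} (coordMap n (Set.Iio i) (Set.Iic i) v) = 0 := by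
  funext t
  have ht : t.1.1 = i := t.2
  rw [coordMap_apply_of_mem _ _ _ _ (show t.1.1 ∈ Set.Iic i from ht.le)]
  exact coordMap_apply_of_notMem _ _ _ _ (show t.1.1 ∉ Set.Iio i from fun h => h.ne ht)

/-- The action of `B{c_i}` on vectors supported in the block `i`. -/
theorem mulVec_coordMap_singleton (B : Matrix (Idx n) (Idx n) ℤ) (i : P)
    (v : BlockIdx n {i} → ℤ) :
    dblock B (Set.Iic i) *ᵥ coordMap n {i} (Set.Iic i) v =
      coordMap n (Set.Iio i) (Set.Iic i) (block B (Set.Iio i) {i} *ᵥ v) +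
        coordMap n {i} (Set.Iic i) (dblock B {i} *ᵥ v) := by
  classical
  have h1 : ∀ t : BlockIdx n (Set.Iic i),
      (dblock B (Set.Iic i) *ᵥ coordMap n {i} (Set.Iic i) v) t =
        ∑ s : BlockIdx n {i}, B t.1 s.1 * v s := by
    intro t
    let g : Idx n → ℤ := fun s => if h : s.1 ∈ ({i} : Set P) then B t.1 s * v ⟨s, h⟩ else 0
    have h2 : (dblock B (Set.Iic i) *ᵥ coordMap n {i} (Set.Iic i) v) t =
        ∑ s : BlockIdx n (Set.Iic i), g s.1 := by
      refine Finset.sum_congr rfl fun s _ => ?_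
      by_cases hs : s.1.1 ∈ ({i} : Set P)
      · rw [coordMap_apply_of_mem _ _ _ _ hs]
        simp only [g, hs, dite_true]
        rfl
      · rw [coordMap_apply_of_notMem _ _ _ _ hs]
        simp only [g, hs, dite_false, mul_zero]
    have h3 : ∑ s : BlockIdx n {i}, B t.1 s.1 * v s = ∑ s : BlockIdx n {i}, g s.1 := by
      refine Finset.sum_congr rfl fun s _ => ?_
      have hs : s.1.1 ∈ ({i} : Set P) := s.2
      simp only [g, hs, dite_true]
      rfl
    rw [h2, h3, sum_block, sum_block]
    refine Finset.sum_congr rfl fun s _ => ?_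
    by_cases hs : s.1 ∈ ({i} : Set P)
    · have hs' : s.1 ∈ Set.Iic i := le_of_eq hs
      simp only [hs, hs', if_true]
    · simp only [g, hs, dite_false, ite_self]
  funext t
  rw [h1, Pi.add_apply]
  rcases (show t.1.1 ≤ i from t.2).lt_or_eq with h | h
  · rw [coordMap_apply_of_mem _ _ _ _ (show t.1.1 ∈ Set.Iio i from h),
      coordMap_apply_of_notMem _ _ _ _ (show t.1.1 ∉ ({i} : Set P) from h.ne), add_zero]
    rfl
  · rw [coordMap_apply_of_notMem _ _ _ _ (show t.1.1 ∉ Set.Iio i from fun h' => h'.ne h),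
      coordMap_apply_of_mem _ _ _ _ (show t.1.1 ∈ ({i} : Set P) from h), zero_add]
    rfl

theorem mul_mem_MP {M N : Matrix (Idx n) (Idx n) ℤ} (hM : M ∈ MP n) (hN : N ∈ MP n) :
    M * N ∈ MP n := by
  refine mem_MP fun x y hxy => Finset.sum_eq_zero fun k _ => ?_
  by_cases h : x.1 ≤ k.1
  · exact mul_eq_zero_of_right _ (MP_apply hN fun h' => hxy (h.trans h'))
  · exact mul_eq_zero_of_left (MP_apply hM h) _

/-- A matrix in `M_P(n, ℤ)` with prescribed columns. -/
theorem exists_mem_MP_of_columns (u : ∀ i : P, (BlockIdx n {i} → ℤ) →ₗ[ℤ]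
    (BlockIdx n (Set.Iic i) → ℤ)) :
    ∃ U ∈ MP n, ∀ (i : P) (v : BlockIdx n {i} → ℤ),
      dblock U (Set.Iic i) *ᵥ coordMap n {i} (Set.Iic i) v = u i v := by
  classical
  let U : Matrix (Idx n) (Idx n) ℤ := fun y x =>
    if h : y.1 ≤ x.1 then u x.1 (unitVec {x.1} x) ⟨y, h⟩ else 0
  refine ⟨U, mem_MP fun x y h => by simp [U, h], fun i v => ?_⟩
  refine LinearMap.congr_fun (f := (dblock U (Set.Iic i)).mulVecLin ∘ₗ coordMap n {i} (Set.Iic i))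
    (g := u i) (linearMap_ext_unitVec fun x hx => ?_) v
  obtain rfl : x.1 = i := hx
  rw [LinearMap.comp_apply, coordMap_unitVec (S := {x.1}) x rfl, Matrix.mulVecLin_apply,
    dblock_mulVec_unitVec U (S := Set.Iic x.1) x (le_refl x.1)]
  funext t
  exact dif_pos t.2

theorem dblock_singleton_mulVec {U : Matrix (Idx n) (Idx n) ℤ} (hU : U ∈ MP n) (i : P)
    (v : BlockIdx n {i} → ℤ) :
    dblock U {i} *ᵥ v = coordMap n (Set.Iic i) {i}
      (dblock U (Set.Iic i) *ᵥ coordMap n {i} (Set.Iic i) v) := by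
  rw [← coordMap_comm hU (compat_Iic_singleton i), coordMap_singleton_Iic]

/-- Two matrices in `M_P(n, ℤ)` are equal if they agree on all columns. -/
theorem eq_of_forall_mulVec {M N : Matrix (Idx n) (Idx n) ℤ} (hM : M ∈ MP n) (hN : N ∈ MP n)
    (h : ∀ (i : P) (v : BlockIdx n {i} → ℤ),
      dblock M (Set.Iic i) *ᵥ coordMap n {i} (Set.Iic i) v =
        dblock N (Set.Iic i) *ᵥ coordMap n {i} (Set.Iic i) v) : M = N := by
  classical
  ext y x
  by_cases hyx : y.1 ≤ x.1
  · have h1 := h x.1 (unitVec {x.1} x)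
    rw [coordMap_unitVec (S := {x.1}) x rfl, dblock_mulVec_unitVec M (S := Set.Iic x.1) x (le_refl x.1),
      dblock_mulVec_unitVec N (S := Set.Iic x.1) x (le_refl x.1)] at h1
    exact congrFun h1 ⟨y, hyx⟩
  · rw [MP_apply hM hyx, MP_apply hN hyx]

/-- Lifting an element of `cok B{c_i}` with prescribed coordinates in the block `i`. -/
theorem exists_lift_cok_Iic (B : MP n) (i : P) (y : cokS B.1 (Set.Iic i)) (z : BlockIdx n {i} → ℤ)
    (h : cokMap B (compat_Iic_singleton i) y = Submodule.Quotient.mk z) :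
    ∃ u : BlockIdx n (Set.Iic i) → ℤ, Submodule.Quotient.mk u = y ∧
      coordMap n (Set.Iic i) {i} u = z := by
  obtain ⟨u, rfl⟩ := Submodule.Quotient.mk_surjective _ y
  obtain ⟨t, ht⟩ := (Submodule.Quotient.eq _).1 h
  rw [Matrix.mulVecLin_apply] at ht
  -- The error in block `i` is `B{i} t`. Subtracting `B{c_i}` applied to `t`, extended by zero,
  -- removes it and keeps the class.
  refine ⟨u - dblock B.1 (Set.Iic i) *ᵥ coordMap n {i} (Set.Iic i) t, ?_, ?_⟩
  · rw [Submodule.Quotient.eq]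
    exact ⟨-coordMap n {i} (Set.Iic i) t, by simp [Matrix.mulVec_neg]⟩
  · rw [map_sub, ← dblock_singleton_mulVec B.2, ht, sub_sub_cancel]

/-! ### Constructing `U` and `V⁻¹` from a `K`-web isomorphism -/

namespace KWebIso

variable {B B' : MP n} (κ : KWebIso B B')

/-- A matrix that induces a `K`-web isomorphism on all cokernels. -/
theorem exists_inducing_cok (e : ∀ i : P, (BlockIdx n {i} → ℤ) ≃ₗ[ℤ] (BlockIdx n {i} → ℤ))
    (he : ∀ i v, κ.cokI i (Submodule.Quotient.mk v) = Submodule.Quotient.mk (e i v)) :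
    ∃ U ∈ GLP n, (∀ i v, dblock U {i} *ᵥ v = e i v) ∧
      (∀ i v, κ.cokC i (Submodule.Quotient.mk v) =
        Submodule.Quotient.mk (dblock U (Set.Iic i) *ᵥ v)) ∧
      (∀ i v, κ.cokR i (Submodule.Quotient.mk v) =
        Submodule.Quotient.mk (dblock U (Set.Iio i) *ᵥ v)) := by
  classical
  have hex : ∀ i : P, ∃ u : (BlockIdx n {i} → ℤ) →ₗ[ℤ] (BlockIdx n (Set.Iic i) → ℤ),
      ∀ v, κ.cokC i (Submodule.Quotient.mk (coordMap n {i} (Set.Iic i) v)) =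
        Submodule.Quotient.mk (u v) ∧ coordMap n (Set.Iic i) {i} (u v) = e i v := by
    intro i
    -- The class in `cok B'{c_i}` and the coordinates in block `i` are prescribed together, as one
    -- map into a product; since `ℤ^i` is free, solvability for each vector suffices.
    obtain ⟨u, hu⟩ := exists_comp_eq_of_forall_mem_range
      ((Submodule.mkQ (LinearMap.range (dblock B'.1 (Set.Iic i)).mulVecLin)).prod
        (coordMap n (Set.Iic i) {i}))
      ((κ.cokC i).toLinearMap ∘ₗ Submodule.mkQ _ ∘ₗ coordMap n {i} (Set.Iic i) |>.prod
        (e i).toLinearMap) (by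
        intro v
        obtain ⟨u, hu1, hu2⟩ := exists_lift_cok_Iic B' i
          (κ.cokC i (Submodule.Quotient.mk (coordMap n {i} (Set.Iic i) v))) (e i v) (by
            rw [← κ.comm_ci, ← he]
            change κ.cokI i (Submodule.Quotient.mk (coordMap n (Set.Iic i) {i}
              (coordMap n {i} (Set.Iic i) v))) = _
            rw [coordMap_singleton_Iic])
        exact ⟨u, Prod.ext hu1 hu2⟩)
    exact ⟨u, fun v => ⟨(congrArg Prod.fst (hu v)).symm, congrArg Prod.snd (hu v)⟩⟩
  choose u hu using hex
  obtain ⟨U, hU, hUu⟩ := exists_mem_MP_of_columns u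
  have hUe : ∀ i v, dblock U {i} *ᵥ v = e i v := fun i v => by
    rw [dblock_singleton_mulVec hU, hUu, (hu i v).2]
  -- Only column block `i` is new at stage `i`, and it is right by construction. A unit vector below
  -- `i` reaches `cok B{r_i}` from some `cok B{c_k}` with `k ⋖ i`, and then `cok B{c_i}`.
  have hCR : ∀ i : P,
      (∀ x : Idx n, x.1 ∈ Set.Iic i → κ.cokC i (Submodule.Quotient.mk (unitVec _ x)) =
        Submodule.Quotient.mk (dblock U (Set.Iic i) *ᵥ unitVec _ x)) ∧
      (∀ x : Idx n, x.1 ∈ Set.Iio i → κ.cokR i (Submodule.Quotient.mk (unitVec _ x)) =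
        Submodule.Quotient.mk (dblock U (Set.Iio i) *ᵥ unitVec _ x)) := by
    intro i
    induction i using WellFoundedLT.induction with
    | _ i ih =>
      have hR : ∀ x : Idx n, x.1 ∈ Set.Iio i →
          κ.cokR i (Submodule.Quotient.mk (unitVec _ x)) =
          Submodule.Quotient.mk (dblock U (Set.Iio i) *ᵥ unitVec _ x) := by
        intro x hx
        obtain ⟨k, hxk, hk⟩ := exists_le_covBy_of_lt hx
        have h1 := κ.comm_cr i k hk (Submodule.Quotient.mk (unitVec _ x))
        rw [(ih k hk.lt).1 x hxk] at h1
        change κ.cokR i (Submodule.Quotient.mk (coordMap n (Set.Iic k) (Set.Iio i) _)) =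
          Submodule.Quotient.mk (coordMap n (Set.Iic k) (Set.Iio i) _) at h1
        rw [← coordMap_comm hU (compat_Iic_Iio hk), coordMap_unitVec x hxk] at h1
        exact h1
      refine ⟨fun x hx => ?_, hR⟩
      rcases (show x.1 ≤ i from hx).lt_or_eq with h | h
      · have h1 := κ.comm_rc i (Submodule.Quotient.mk (unitVec _ x))
        rw [hR x h] at h1
        change κ.cokC i (Submodule.Quotient.mk (coordMap n (Set.Iio i) (Set.Iic i) _)) =
          Submodule.Quotient.mk (coordMap n (Set.Iio i) (Set.Iic i) _) at h1
        rw [← coordMap_comm hU (compat_Iio_Iic i),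
          coordMap_unitVec x (show x.1 ∈ Set.Iio i from h)] at h1
        exact h1
      · rw [← coordMap_unitVec x (show x.1 ∈ ({i} : Set P) from h), (hu i _).1, hUu]
  refine ⟨U, ⟨hU, fun i => Matrix.mulVec_surjective_iff_isUnit.1 fun y =>
    ⟨(e i).symm y, by rw [hUe, LinearEquiv.apply_symm_apply]⟩⟩, hUe, fun i v => ?_, fun i v => ?_⟩
  · refine LinearMap.congr_fun (f := (κ.cokC i).toLinearMap ∘ₗ Submodule.mkQ _)
      (g := Submodule.mkQ _ ∘ₗ (dblock U (Set.Iic i)).mulVecLin)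
      (linearMap_ext_unitVec fun x hx => (hCR i).1 x hx) v
  · refine LinearMap.congr_fun (f := (κ.cokR i).toLinearMap ∘ₗ Submodule.mkQ _)
      (g := Submodule.mkQ _ ∘ₗ (dblock U (Set.Iio i)).mulVecLin)
      (linearMap_ext_unitVec fun x hx => (hCR i).2 x hx) v

/-- The columns of `V⁻¹` in the block `i`. -/
theorem exists_column {U : Matrix (Idx n) (Idx n) ℤ} (hU : U ∈ MP n) (i : P)
    (hC : ∀ v, κ.cokC i (Submodule.Quotient.mk v) =
      Submodule.Quotient.mk (dblock U (Set.Iic i) *ᵥ v))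
    (hR : ∀ v, κ.cokR i (Submodule.Quotient.mk v) =
      Submodule.Quotient.mk (dblock U (Set.Iio i) *ᵥ v))
    (k : kerS B.1 {i} ≃ₗ[ℤ] kerS B'.1 {i})
    (hk : ∀ v, κ.cokR i (connecting B i v) = connecting B' i (k v)) :
    ∃ w : (BlockIdx n {i} → ℤ) →ₗ[ℤ] (BlockIdx n (Set.Iic i) → ℤ),
      (∀ v, dblock B'.1 (Set.Iic i) *ᵥ w v = dblock U (Set.Iic i) *ᵥ
        (dblock B.1 (Set.Iic i) *ᵥ coordMap n {i} (Set.Iic i) v)) ∧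
      ∀ v : kerS B.1 {i}, coordMap n (Set.Iic i) {i} (w v) = k v := by
  let f := (dblock B.1 {i}).mulVecLin
  let T : (BlockIdx n {i} → ℤ) →ₗ[ℤ] (BlockIdx n (Set.Iic i) → ℤ) :=
    (dblock U (Set.Iic i)).mulVecLin ∘ₗ (dblock B.1 (Set.Iic i)).mulVecLin ∘ₗ
      coordMap n {i} (Set.Iic i)
  -- The image of `B{i}` is free, so `ℤ^i` splits as `ker B{i}` plus a complement `s(im)`. The
  -- column is built separately: `w₀` on the kernel, and any solution `c` on the complement.
  obtain ⟨s, hs⟩ := exists_comp_eq_of_forall_mem_range f (LinearMap.range f).subtype (fun y => y.2)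
  obtain ⟨c, hc⟩ := exists_comp_eq_of_forall_mem_range (dblock B'.1 (Set.Iic i)).mulVecLin (T ∘ₗ s)
    (fun y => by
      have h1 := hC (dblock B.1 (Set.Iic i) *ᵥ coordMap n {i} (Set.Iic i) (s y))
      have h2 : (Submodule.Quotient.mk (dblock B.1 (Set.Iic i) *ᵥ coordMap n {i} (Set.Iic i) (s y)) :
          cokS B.1 (Set.Iic i)) = 0 := (Submodule.Quotient.mk_eq_zero _).2 ⟨_, rfl⟩
      rw [h2, map_zero, eq_comm, Submodule.Quotient.mk_eq_zero] at h1
      exact h1)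
  obtain ⟨w₀, hw₀⟩ := exists_comp_eq_of_forall_mem_range
    ((dblock B'.1 (Set.Iic i)).mulVecLin.prod (coordMap n (Set.Iic i) {i}))
    ((T ∘ₗ (kerS B.1 {i}).subtype).prod ((kerS B'.1 {i}).subtype ∘ₗ k.toLinearMap)) (by
      intro v
      have hv : dblock B.1 {i} *ᵥ v.1 = 0 := v.2
      have hkv : dblock B'.1 {i} *ᵥ (k v).1 = 0 := (k v).2
      have h1 := (hR (block B.1 (Set.Iio i) {i} *ᵥ v.1)).symm.trans (hk v)
      -- Compatibility with the connecting maps gives `B'{r_i} y = U{r_i} B{r_i,i} v - B'{r_i,i} (k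
      -- v)`, so the vector with parts `y` in `r_i` and `k v` in `i` solves the equation.
      obtain ⟨y, hy⟩ := (Submodule.Quotient.eq _).1 h1
      refine ⟨coordMap n (Set.Iio i) (Set.Iic i) y + coordMap n {i} (Set.Iic i) (k v).1, ?_⟩
      refine Prod.ext ?_ ?_
      · change dblock B'.1 (Set.Iic i) *ᵥ _ = dblock U (Set.Iic i) *ᵥ
          (dblock B.1 (Set.Iic i) *ᵥ coordMap n {i} (Set.Iic i) v.1)
        rw [Matrix.mulVec_add, mulVec_coordMap_singleton, mulVec_coordMap_singleton, hv, hkv]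
        simp only [map_zero, add_zero]
        rw [coordMap_comm hU (compat_Iio_Iic i),
          coordMap_comm B'.2 (compat_Iio_Iic i), ← map_add]
        congr 1
        rw [Matrix.mulVecLin_apply] at hy
        rw [hy]
        exact sub_add_cancel _ _
      · change coordMap n (Set.Iic i) {i} _ = (k v).1
        rw [map_add, coordMap_Iio_Iic_singleton, coordMap_singleton_Iic, zero_add])
  have hfs : ∀ v, f (v - s (f.rangeRestrict v)) = 0 := fun v => by
    rw [map_sub, hs]
    exact sub_self _
  let π : (BlockIdx n {i} → ℤ) →ₗ[ℤ] kerS B.1 {i} :=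
    (LinearMap.id - s ∘ₗ f.rangeRestrict).codRestrict _ hfs
  refine ⟨w₀ ∘ₗ π + c ∘ₗ f.rangeRestrict, fun v => ?_, fun v => ?_⟩
  · have h1 : dblock B'.1 (Set.Iic i) *ᵥ w₀ (π v) = T (v - s (f.rangeRestrict v)) :=
      congrArg Prod.fst (hw₀ (π v))
    have h2 : dblock B'.1 (Set.Iic i) *ᵥ c (f.rangeRestrict v) = T (s (f.rangeRestrict v)) :=
      hc (f.rangeRestrict v)
    rw [LinearMap.add_apply, Matrix.mulVec_add, LinearMap.comp_apply, LinearMap.comp_apply, h1, h2,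
      map_sub, sub_add_cancel]
    rfl
  · have h0 : f.rangeRestrict v.1 = 0 := Subtype.ext v.2
    have h1 : π v.1 = v := Subtype.ext (by
      change v.1 - s (f.rangeRestrict v.1) = v.1
      rw [h0, map_zero, sub_zero])
    rw [LinearMap.add_apply, LinearMap.comp_apply, LinearMap.comp_apply, h0, h1, map_zero, add_zero]
    exact congrArg Prod.snd (hw₀ v)

end KWebIso

/-- An endomorphism compatible with isomorphisms of cokernels and kernels is surjective. -/
theorem surjective_of_ker_cok {B B' : MP n} {i : P} (φ : cokS B.1 {i} ≃ₗ[ℤ] cokS B'.1 {i})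
    (e : (BlockIdx n {i} → ℤ) ≃ₗ[ℤ] (BlockIdx n {i} → ℤ))
    (he : ∀ v, φ (Submodule.Quotient.mk v) = Submodule.Quotient.mk (e v))
    (k : kerS B.1 {i} ≃ₗ[ℤ] kerS B'.1 {i}) (W : Matrix (BlockIdx n {i}) (BlockIdx n {i}) ℤ)
    (hW : ∀ v, dblock B'.1 {i} *ᵥ (W *ᵥ v) = e (dblock B.1 {i} *ᵥ v))
    (hk : ∀ v : kerS B.1 {i}, W *ᵥ v.1 = k v) : Function.Surjective W.mulVec := by
  intro y
  -- Half of the five lemma: injectivity of `φ` yields `v` with `e (B{i} v) = B'{i} y`, so `y - W v`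
  -- lies in `ker B'{i}`, which `k` reaches.
  have h1 : φ (Submodule.Quotient.mk (e.symm (dblock B'.1 {i} *ᵥ y))) = 0 := by
    rw [he, LinearEquiv.apply_symm_apply]
    exact (Submodule.Quotient.mk_eq_zero _).2 ⟨y, rfl⟩
  rw [LinearEquiv.map_eq_zero_iff, Submodule.Quotient.mk_eq_zero] at h1
  obtain ⟨v, hv⟩ := h1
  have hv' : e (dblock B.1 {i} *ᵥ v) = dblock B'.1 {i} *ᵥ y := by
    rw [← Matrix.mulVecLin_apply, hv, LinearEquiv.apply_symm_apply]
  have hmem : y - W *ᵥ v ∈ kerS B'.1 {i} := by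
    rw [LinearMap.mem_ker, Matrix.mulVecLin_apply, Matrix.mulVec_sub, hW, hv', sub_self]
  refine ⟨(k.symm ⟨_, hmem⟩ : kerS B.1 {i}).1 + v, ?_⟩
  rw [Matrix.mulVec_add, hk, LinearEquiv.apply_symm_apply]
  exact sub_add_cancel _ _

theorem inv_mem_GLP {W : Matrix (Idx n) (Idx n) ℤ} (hW : W ∈ GLP n) : W⁻¹ ∈ GLP n :=
  ⟨inv_mem_MP hW, fun _ => IsUnit.of_mul_eq_one _ (dblock_inv_mul hW Set.ordConnected_singleton)⟩

end PosetBlock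

end

/-! ### Assembling the equivalence -/

theorem mainTheorem12 {P : Type*} [PartialOrder P] [Fintype P] [DecidableEq P]
    (n : P → ℕ) (hn : ∀ i, n i ≠ 0) (B B' : PosetBlock.MP n)
    (hgcd : ∀ i, PosetBlock.blockGcd B.1 i = PosetBlock.blockGcd B'.1 i ∧
      (PosetBlock.blockGcd B.1 i = 0 ∨ PosetBlock.blockGcd B.1 i = 1))
    (κ : PosetBlock.KWebIso B B')
    (ψ : ∀ i : P, IsMin i → (PosetBlock.kerS B.1 {i} ≃ₗ[ℤ] PosetBlock.kerS B'.1 {i})) :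
    ∃ E : PosetBlock.GLPEquiv B B',
      E.toKWebIso = κ ∧
      ∀ (i : P) (hi : IsMin i) (v : PosetBlock.kerS B.1 {i}),
        (ψ i hi v : PosetBlock.BlockIdx n {i} → ℤ) =
          (PosetBlock.dblock (E.V)⁻¹ {i}).mulVec (v : PosetBlock.BlockIdx n {i} → ℤ) := by
  classical
  open PosetBlock in
  choose e he using fun i => exists_equiv_lift_cok (hgcd i) (κ.cokI i)
  obtain ⟨U, hU, hUe, hC, hR⟩ := κ.exists_inducing_cok e he
  -- At minimal `i` the connecting map lands in the zero group `cok B'{∅}`, so an arbitrary `ψ i` is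
  -- compatible and can be treated like a component of `κ`.
  let k : ∀ i : P, kerS B.1 {i} ≃ₗ[ℤ] kerS B'.1 {i} := fun i =>
    if hi : IsMin i then ψ i hi else κ.kerI i hi
  have hk : ∀ i v, κ.cokR i (connecting B i v) = connecting B' i (k i v) := by
    intro i v
    by_cases hi : IsMin i
    · have : IsEmpty (BlockIdx n (Set.Iio i)) :=
        ⟨fun x => (hi.not_lt (show x.1.1 < i from x.2)).elim⟩
      have : Subsingleton (cokS B'.1 (Set.Iio i)) :=
        (Submodule.Quotient.mk_surjective _).subsingleton
      exact Subsingleton.elim _ _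
    · simp only [k, hi, dite_false]
      exact κ.comm_ker i hi v
  choose w hw hwk using fun i => κ.exists_column hU.1 i (hC i) (hR i) (k i) (hk i)
  -- `W` plays the role of `V⁻¹`; the equation `U B = B' W` can be checked on column blocks.
  obtain ⟨W, hW, hWw⟩ := exists_mem_MP_of_columns w
  have hBW : U * B.1 = B'.1 * W := by
    refine eq_of_forall_mulVec (mul_mem_MP hU.1 B.2) (mul_mem_MP B'.2 hW) fun i v => ?_
    rw [dblock_mul hU.1 B.2 Set.ordConnected_Iic, dblock_mul B'.2 hW Set.ordConnected_Iic,
      ← Matrix.mulVec_mulVec, ← Matrix.mulVec_mulVec, hWw, hw]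
  have hWk : ∀ i (v : kerS B.1 {i}), dblock W {i} *ᵥ v.1 = k i v := fun i v => by
    rw [dblock_singleton_mulVec hW, hWw, hwk]
  have hWG : W ∈ GLP n := ⟨hW, fun i => Matrix.mulVec_surjective_iff_isUnit.1 <|
    surjective_of_ker_cok (κ.cokI i) (e i) (he i) (k i) _ (fun v => by
      rw [← hUe, Matrix.mulVec_mulVec, Matrix.mulVec_mulVec,
        ← dblock_mul hU.1 B.2 Set.ordConnected_singleton, hBW,
        dblock_mul B'.2 hW Set.ordConnected_singleton]) (hWk i)⟩
  have hinv : W⁻¹⁻¹ = W := Matrix.nonsing_inv_nonsing_inv _ (isUnit_of_GLP hWG)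
  let E : GLPEquiv B B' := ⟨U, W⁻¹, hU, inv_mem_GLP hWG, by
    rw [hBW, Matrix.mul_nonsing_inv_cancel_right _ _ (isUnit_of_GLP hWG)]⟩
  refine ⟨E, ?_, fun i hi v => ?_⟩
  · apply KWebIso.ext
    · funext i hi
      refine LinearEquiv.ext fun v => Subtype.ext ?_
      change dblock W⁻¹⁻¹ {i} *ᵥ v.1 = _
      rw [hinv, hWk]
      simp only [k, hi, dite_false]
    · funext i
      refine LinearEquiv.ext fun x => ?_
      obtain ⟨x, rfl⟩ := Submodule.Quotient.mk_surjective _ x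
      exact (hR i x).symm
    · funext i
      refine LinearEquiv.ext fun x => ?_
      obtain ⟨x, rfl⟩ := Submodule.Quotient.mk_surjective _ x
      exact (hC i x).symm
    · funext i
      refine LinearEquiv.ext fun x => ?_
      obtain ⟨x, rfl⟩ := Submodule.Quotient.mk_surjective _ x
      rw [he, ← hUe]
      rfl
  · change _ = dblock W⁻¹⁻¹ {i} *ᵥ v.1
    rw [hinv, hWk]
    simp only [k, hi, dite_true]
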